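/- For $n\ge 1$, $1\le j\le n$ and $0\le a\le 3$ let $\sigma_j^{(a)}=I_2^{\otimes(j-1)}\otimes\sigma^{(a)}\otimes I_2^{\otimes(n-j)}$ be the operator on $(\mathbb C^2)^{\otimes n}$ which acts as $\sigma^{(a)}$ on the $j$-th factor, where $$\sigma^{(0)}=I_2=\begin{pmatrix}1&0\\0&1\end{pmatrix},\quad \sigma^{(1)}=\begin{pmatrix}0&1\\1&0\end{pmatrix},\quad \sigma^{(2)}=\begin{pmatrix}0&-\mathrm i\\ \mathrm i&0\end{pmatrix},\quad \sigma^{(3)}=\begin{pmatrix}1&0\\0&-1\end{pmatrix},$$ and set $\sigma_{n+1}^{(a)}=\sigma_1^{(a)}$. For $\boldsymbol\alpha=(\alpha_{a,b})_{0\le a\le 3,\,1\le b\le 3}\in\mathbb R^{12}$ define the $2^n\times 2^n$ Hermitian matrix $$H_n^{(inv)}(\boldsymbol\alpha)=\frac1{\sqrt n}\sum_{j=1}^n\sum_{a=0}^3\sum_{b=1}^3\alpha_{a,b}\,\sigma_j^{(a)}\sigma_{j+1}^{(b)} .$$ **Lemma.** Let $n$ be an odd prime. Then $H_n^{(inv)}(\boldsymbol\alpha)$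 has a non-degenerate spectrum (every eigenvalue has a one-dimensional eigenspace, equivalently no eigenvalue is repeated) for generic $\boldsymbol\alpha$: the set of those $\boldsymbol\alpha\in\mathbb R^{12}$ for which $H_n^{(inv)}(\boldsymbol\alpha)$ has a degenerate eigenvalue has Lebesgue measure zero. -/

import Mathlib

namespace SpinChain

/-- The matrices `σ⁽⁰⁾ = I₂`, `σ⁽¹⁾`, `σ⁽²⁾`, `σ⁽³⁾`. -/
def pauli : Fin 4 → Matrix (Fin 2) (Fin 2) ℂ :=
  ![!![1, 0; 0, 1],
    !![0, 1; 1, 0],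
    !![0, -Complex.I; Complex.I, 0],
    !![1, 0; 0, -1]]

/-- The tensor (Kronecker) product `A₁ ⊗ ⋯ ⊗ Aₙ` of `n` matrices of size `2 × 2`, acting on
`(ℂ²)^{⊗ n}`. The rows and columns are indexed by the product basis, that is by `{0, 1}ⁿ`. -/
def tensorProd {n : ℕ} (A : Fin n → Matrix (Fin 2) (Fin 2) ℂ) :
    Matrix (Fin n → Fin 2) (Fin n → Fin 2) ℂ :=
  Matrix.of fun x y => ∏ k, A k (x k) (y k)

/-- `σ_j⁽ᵃ⁾ = I₂ ⊗ ⋯ ⊗ I₂ ⊗ σ⁽ᵃ⁾ ⊗ I₂ ⊗ ⋯ ⊗ I₂`, with `σ⁽ᵃ⁾` in position `j`. -/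
def site {n : ℕ} (a : Fin 4) (j : Fin n) : Matrix (Fin n → Fin 2) (Fin n → Fin 2) ℂ :=
  tensorProd (Function.update (fun _ => (1 : Matrix (Fin 2) (Fin 2) ℂ)) j (pauli a))

/-- The translation invariant nearest-neighbour Hamiltonian
`n^{-1/2} ∑_j ∑_{a=0}^3 ∑_{b=1}^3 α_{a,b} σ_j⁽ᵃ⁾ σ_{j+1}⁽ᵇ⁾` on a ring of `n` qubits.
The entry of `α` at `(a, b)`, with `b : Fin 3`, is the coefficient `α_{a,b+1}`, and
`finRotate n` is the cyclic shift `j ↦ j + 1` of the sites. -/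
noncomputable def hamiltonian (n : ℕ) (α : Fin 4 × Fin 3 → ℝ) :
    Matrix (Fin n → Fin 2) (Fin n → Fin 2) ℂ :=
  ((1 / Real.sqrt (n : ℝ) : ℝ) : ℂ) •
    ∑ j : Fin n, ∑ a : Fin 4, ∑ b : Fin 3,
      (α (a, b) : ℂ) • (site a j * site b.succ (finRotate n j))

/-- A complex square matrix has non-degenerate spectrum: each of its eigenvalues has a
one-dimensional eigenspace. (For a Hermitian matrix this says that no eigenvalue is repeated.) -/
def NondegenerateSpectrum {ι : Type*} [Fintype ι] [DecidableEq ι] (A : Matrix ι ι ℂ) : Prop :=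
  ∀ μ : ℂ, Module.End.HasEigenvalue (Matrix.toLin' A) μ →
    Module.finrank ℂ (Module.End.eigenspace (Matrix.toLin' A) μ) = 1

end SpinChain

/-!
A matrix is nondegenerate if its characteristic polynomial is separable, that is, if the resultant of
this polynomial with its derivative does not vanish. The resultant is a polynomial in the entries.
The Hamiltonian is linear in its couplings. So one point of `ℂ¹²` with a separable characteristic
polynomial suffices: along a complex line the resultant is a polynomial in one variable, which gives
first a real point `w` of this kind and then, on every real line of direction `w`, separability up to
finitely many points (`Matrix.ae_separable_charpoly`).

At complex points Hermiticity can be given up, and the witness is the one-way hopping operator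
`∑_j (σ⁻_j σ⁺_{j+1} + (n + 1) Z_j)`. It describes free fermions on a ring: for each set `S` of sites,
read as momenta, the Slater determinant of the plane waves with multipliers `ε ω^k`, `k ∈ S`, is an
eigenvector, where `ω` is a primitive `n`-th root of unity and the sign `ε = (-1)^(|S|-1)` accounts
for the reordering of the particles when one of them crosses the boundary (`sum_amplitude_hop`). As
`n` is odd, `ε ^ n = ε`, so these multipliers satisfy the boundary condition. The eigenvalue is
`ε ∑_{k ∈ S} ω^k + (n + 1) (n - 2 |S|)`. The second term determines `|S|`, and then, `n` being prime,
the sum `∑_{k ∈ S} ω^k` determines `S`, because `1 + ω + ⋯ + ω^(n-1) = 0` is the only rational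
relation between the powers of `ω` (`eq_of_sum_pow_eq`). Hence the `2^n` eigenvalues are distinct.
-/

/-! ### Separability of the characteristic polynomial on lines -/

section

open Polynomial

/-- The resultant of the characteristic polynomial of `A` with its derivative. The degrees are
prescribed, so that its formation commutes with every ring homomorphism. -/
noncomputable def Matrix.charpolyResultant {ι R : Type*} [Fintype ι] [DecidableEq ι] [CommRing R]
    (A : Matrix ι ι R) : R :=
  resultant A.charpoly (derivative A.charpoly) (Fintype.card ι) (Fintype.card ι - 1)

namespace Matrix

variable {ι : Type*} [Fintype ι] [DecidableEq ι]

theorem charpolyResultant_map {R S : Type*} [CommRing R] [CommRing S] (φ : R →+* S)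
    (A : Matrix ι ι R) : (A.map φ).charpolyResultant = φ A.charpolyResultant := by
  rw [charpolyResultant, charpolyResultant, charpoly_map, derivative_map, resultant_map_map]

theorem charpolyResultant_ne_zero_iff {K : Type*} [Field K] [CharZero K] (A : Matrix ι ι K) :
    A.charpolyResultant ≠ 0 ↔ A.charpoly.Separable := by
  have h1 : A.charpoly.natDegree = Fintype.card ι := A.charpoly_natDegree_eq_dim
  have h2 : (derivative A.charpoly).natDegree = Fintype.card ι - 1 := by
    rw [natDegree_derivative, h1]
  have h : A.charpolyResultant = resultant A.charpoly (derivative A.charpoly) := by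
    rw [charpolyResultant, h1, h2]
  rw [h, Polynomial.Separable, Ne, resultant_eq_zero_iff]
  simp [A.charpoly_monic.ne_zero]

/-- The resultant is a polynomial in the entries of the matrix. -/
theorem continuous_charpolyResultant :
    Continuous (charpolyResultant : Matrix ι ι ℂ → ℂ) := by
  have h : (charpolyResultant : Matrix ι ι ℂ → ℂ) = fun A =>
      MvPolynomial.eval (fun p : ι × ι => A p.1 p.2)
        (charpolyResultant (mvPolynomialX ι ι ℂ)) := by
    funext A
    rw [← charpolyResultant_map]
    congr 1
    ext i j
    simp [mvPolynomialX]
  rw [h]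
  refine (MvPolynomial.continuous_eval _).comp ?_
  fun_prop

/-- On the line `A + s B` the resultant is a polynomial in `s`, so if it does not vanish
identically then it has finitely many zeros. -/
theorem finite_not_separable_line {A B : Matrix ι ι ℂ} {s₀ : ℂ}
    (h : (A + s₀ • B).charpoly.Separable) :
    {s : ℂ | ¬ (A + s • B).charpoly.Separable}.Finite := by
  set M : Matrix ι ι ℂ[X] := A.map C + (X : ℂ[X]) • B.map C with hM
  have key (s : ℂ) : (A + s • B).charpolyResultant = M.charpolyResultant.eval s := by
    rw [← coe_evalRingHom, ← charpolyResultant_map]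
    congr 1
    ext i j
    simp [hM]
    exact mul_comm _ _
  have hne : M.charpolyResultant ≠ 0 := by
    intro h0
    rw [← charpolyResultant_ne_zero_iff, key, h0] at h
    simp at h
  refine (M.charpolyResultant.roots.toFinset.finite_toSet).subset fun s hs => ?_
  rw [Set.mem_ofPred_eq, ← charpolyResultant_ne_zero_iff, not_not, key] at hs
  simpa [hne] using hs

/-- Multiplying a matrix by a nonzero scalar rescales the variable of its characteristic polynomial,
which preserves separability. -/
theorem charpoly_smul_separable {c : ℂ} (hc : c ≠ 0) {A : Matrix ι ι ℂ}
    (h : A.charpoly.Separable) : (c • A).charpoly.Separable := by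
  have hmat : (c • A).charmatrix = (C c : ℂ[X]) •
      (compRingHom (C c⁻¹ * X : ℂ[X])).mapMatrix A.charmatrix := by
    ext1 i j
    have hcc : (C c : ℂ[X]) * C c⁻¹ = 1 := by rw [← C_mul, mul_inv_cancel₀ hc, C_1]
    by_cases hij : i = j
    · subst hij
      simp only [charmatrix_apply_eq, smul_apply, RingHom.mapMatrix_apply, map_apply,
        coe_compRingHom_apply, sub_comp, X_comp, C_comp, smul_eq_mul, C_mul]
      linear_combination (-X : ℂ[X]) * hcc
    · simp [charmatrix_apply_ne _ _ _ hij]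
  have hp : (c • A).charpoly =
      C (c ^ Fintype.card ι) * A.charpoly.comp (C c⁻¹ * X) := by
    rw [charpoly, hmat, det_smul, ← RingHom.map_det, charpoly, C_pow, coe_compRingHom_apply]
  have hu : IsUnit (C (c ^ Fintype.card ι) : ℂ[X]) :=
    isUnit_C.2 (pow_ne_zero _ hc).isUnit
  have hv : IsUnit (C c⁻¹ : ℂ[X]) := isUnit_C.2 (inv_ne_zero hc).isUnit
  have hcop : IsCoprime (A.charpoly.comp (C c⁻¹ * X))
      ((derivative A.charpoly).comp (C c⁻¹ * X)) :=
    IsCoprime.map h (compRingHom (C c⁻¹ * X : ℂ[X]))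
  rw [hp, Separable, derivative_C_mul, derivative_comp, derivative_C_mul_X,
    isCoprime_mul_unit_left hu]
  exact (isCoprime_mul_unit_left_right hv _ _).2 hcop

/-- If some complex combination `L u + i L v` has separable characteristic polynomial, so has
`L α` for almost every real parameter `α`. -/
theorem ae_separable_charpoly {E : Type*} [NormedAddCommGroup E] [NormedSpace ℝ E]
    [FiniteDimensional ℝ E] [MeasurableSpace E] [BorelSpace E]
    (μ : MeasureTheory.Measure E) [μ.IsAddHaarMeasure] (L : E →ₗ[ℝ] Matrix ι ι ℂ) (u v : E)
    (h : (L u + Complex.I • L v).charpoly.Separable) :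
    ∀ᵐ α ∂μ, (L α).charpoly.Separable := by
  have hL (x y : E) (t : ℝ) : L (x + t • y) = L x + (t : ℂ) • L y := by
    rw [map_add, map_smul, Complex.coe_smul]
  have hinj : Function.Injective (fun t : ℝ => (t : ℂ)) := Complex.ofReal_injective
  -- A polynomial in `s` that is nonzero at `s = i` is nonzero at some real `s`.
  obtain ⟨w, hw⟩ : ∃ w : E, (L w).charpoly.Separable := by
    obtain ⟨s, hs⟩ :=
      ((finite_not_separable_line h).preimage hinj.injOn).infinite_compl.nonempty
    refine ⟨u + s • v, ?_⟩
    rw [hL]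
    exact not_not.1 hs
  have hcont : Continuous fun α : E => (L α).charpolyResultant :=
    continuous_charpolyResultant.comp L.continuous_of_finiteDimensional
  have hmeas : MeasurableSet {α : E | (L α).charpoly.Separable} := by
    simp_rw [← charpolyResultant_ne_zero_iff]
    exact (isOpen_ne.preimage hcont).measurableSet
  refine MeasureTheory.ae_mem_of_ae_add_linearMap_mem
    ((LinearMap.toSpanSingleton ℝ E w)) MeasureTheory.volume μ hmeas fun y => ?_
  have hfin : {s : ℂ | ¬ (L w + s • L y).charpoly.Separable}.Finite :=
    finite_not_separable_line (s₀ := 0) (by rwa [zero_smul, add_zero])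
  -- `y + t w = t (w + t⁻¹ y)`, and scaling does not affect separability.
  have hfin' : {t : ℝ | ¬ (L (y + t • w)).charpoly.Separable}.Finite := by
    have hinj' : Function.Injective (fun t : ℝ => ((t⁻¹ : ℝ) : ℂ)) :=
      Complex.ofReal_injective.comp inv_injective
    refine ((hfin.preimage hinj'.injOn).union (Set.finite_singleton 0)).subset ?_
    intro t ht
    by_cases ht0 : t = 0
    · right; exact ht0
    left
    rw [Set.mem_preimage, Set.mem_ofPred_eq]
    intro hsep
    have hc : (t : ℂ) ≠ 0 := by exact_mod_cast ht0
    apply ht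
    have := charpoly_smul_separable hc hsep
    rwa [smul_add, smul_smul, Complex.ofReal_inv, mul_inv_cancel₀ hc, one_smul, add_comm,
      ← hL] at this
  have h0 := (Set.Finite.measure_zero hfin' MeasureTheory.volume)
  exact MeasureTheory.ae_iff.2 h0

end Matrix

namespace SpinChain

theorem nondegenerateSpectrum_of_separable {ι : Type*} [Fintype ι] [DecidableEq ι]
    {A : Matrix ι ι ℂ} (h : A.charpoly.Separable) : NondegenerateSpectrum A := by
  intro μ hμ
  have h1 := LinearMap.finrank_eigenspace_le (Matrix.toLin' A) μ
  have h2 : (Matrix.toLin' A).charpoly.rootMultiplicity μ ≤ 1 := by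
    rw [Matrix.charpoly_toLin']
    exact rootMultiplicity_le_one_of_separable h μ
  have h3 : 0 < Module.finrank ℂ (Module.End.eigenspace (Matrix.toLin' A) μ) := by
    exact Module.End.pos_finrank_genEigenspace_of_hasEigenvalue hμ Nat.zero_lt_one
  omega

end SpinChain

end

/-! ### Slater determinants on a ring -/

section

open Finset

namespace SpinChain

/-- The Slater determinant `det (z_a ^ f_b)` of `m` plane waves with multipliers `z_a`, evaluated
at the positions `f_b`. -/
noncomputable def slater {m : ℕ} (z : Fin m → ℂ) (f : Fin m → ℕ) : ℂ :=
  (Matrix.of fun a b => z a ^ f b).det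

section Slater

variable {m : ℕ} (z : Fin m → ℂ)

/-- Moving the particles one step to the right, one at a time, multiplies a Slater determinant by
the sum of the multipliers. -/
theorem sum_slater_update_succ (f : Fin m → ℕ) :
    ∑ b, slater z (Function.update f b (f b + 1)) = (∑ a, z a) * slater z f := by
  simp only [slater, Matrix.det_apply, Matrix.of_apply]
  rw [sum_comm, mul_sum]
  refine sum_congr rfl fun σ _ => ?_
  rw [← smul_sum, mul_smul_comm, ← Equiv.sum_comp σ z, sum_mul]
  congr 1
  refine sum_congr rfl fun b _ => ?_
  rw [← mul_prod_erase univ _ (mem_univ b), ← mul_prod_erase univ (fun i => z (σ i) ^ f i)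
    (mem_univ b), Function.update_self, pow_succ', mul_assoc]
  congr 2
  refine prod_congr rfl fun i hi => ?_
  rw [Function.update_of_ne (ne_of_mem_erase hi)]

theorem slater_eq_zero {f : Fin m → ℕ} {i j : Fin m} (hij : i ≠ j) (h : f i = f j) :
    slater z f = 0 :=
  Matrix.det_zero_of_column_eq hij fun k => by simp [h]

theorem slater_comp_perm (f : Fin m → ℕ) (σ : Equiv.Perm (Fin m)) :
    slater z (f ∘ σ) = (Equiv.Perm.sign σ : ℤ) * slater z f :=
  Matrix.det_permute' σ (Matrix.of fun a b => z a ^ f b)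

theorem slater_update_period {c : ℂ} {n : ℕ} (hz : ∀ a, z a ^ n = c) (f : Fin m → ℕ)
    (b : Fin m) :
    slater z (Function.update f b n) = c * slater z (Function.update f b 0) := by
  have h (k : ℕ) : (Matrix.of fun a i => z a ^ Function.update f b k i) =
      (Matrix.of fun a i => z a ^ f i).updateCol b fun a => z a ^ k := by
    ext a i
    by_cases hi : i = b
    · subst hi; simp
    · simp [hi]
  have hc : (fun a => z a ^ n) = c • fun a => z a ^ 0 := by
    funext a; simp [hz]
  rw [slater, slater, h, h, hc, Matrix.det_updateCol_smul]

end Slater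

variable {n m : ℕ}

/-- The amplitude of the configuration with occupied sites `s` in the state with multipliers `z`:
the Slater determinant at the sites of `s` in increasing order, or zero if the number of particles
is not `m`. -/
noncomputable def amplitude (z : Fin m → ℂ) (s : Finset (Fin n)) : ℂ :=
  if h : s.card = m then slater z fun b => (s.orderEmbOfFin h b : ℕ) else 0

theorem amplitude_eq_slater (z : Fin m → ℂ) {s : Finset (Fin n)} (hs : s.card = m)
    {g : Fin m → Fin n} (hg : StrictMono g) (hmem : ∀ b, g b ∈ s) :
    amplitude z s = slater z fun b => (g b : ℕ) := by
  rw [amplitude, dif_pos hs, orderEmbOfFin_unique hs hmem hg]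

/-- The effect of moving a single particle. The antiperiodicity for even particle number
compensates the sign of the cyclic permutation that reorders the particles when the last one
crosses the boundary. -/
theorem slater_hop (hn : 2 ≤ n) {z : Fin m → ℂ} (hz : ∀ a, z a ^ n = (-1) ^ (m - 1))
    {s : Finset (Fin n)} (hs : s.card = m) (b : Fin m) :
    slater z (Function.update (fun i => (s.orderEmbOfFin hs i : ℕ)) b
      ((s.orderEmbOfFin hs b : ℕ) + 1)) =
    if finRotate n (s.orderEmbOfFin hs b) ∈ s then 0 else
      amplitude z (insert (finRotate n (s.orderEmbOfFin hs b))
        (s.erase (s.orderEmbOfFin hs b))) := by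
  obtain ⟨n, rfl⟩ : ∃ k, n = k + 1 := ⟨n - 1, by omega⟩
  set f := s.orderEmbOfFin hs with hf
  have hfs (i : Fin m) : f i ∈ s := orderEmbOfFin_mem s hs i
  have hsurj {x : Fin (n + 1)} (hx : x ∈ s) : ∃ i, f i = x := by
    have : x ∈ Set.range f := by rw [hf, range_orderEmbOfFin]; exact hx
    exact this
  have hcard : finRotate (n + 1) (f b) ∉ s →
      (insert (finRotate (n + 1) (f b)) (s.erase (f b))).card = m := by
    intro h
    rw [card_insert_of_notMem (fun h' => h (mem_of_mem_erase h')),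
      card_erase_of_mem (hfs b), hs]
    have := b.pos
    omega
  have hmem (i : Fin m) : Function.update f b (finRotate (n + 1) (f b)) i ∈
      insert (finRotate (n + 1) (f b)) (s.erase (f b)) := by
    by_cases hi : i = b
    · subst hi; simp
    · rw [Function.update_of_ne hi]
      exact mem_insert_of_mem (mem_erase.2 ⟨fun h => hi (f.injective h), hfs i⟩)
  by_cases hlast : f b = Fin.last n
  -- The particle crosses the boundary, from the last site to the first.
  · have hr : finRotate (n + 1) (f b) = 0 := by rw [hlast, finRotate_last]
    have hval : (f b : ℕ) + 1 = n + 1 := by rw [hlast, Fin.val_last]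
    rw [hval, slater_update_period z hz, hr]
    split_ifs with h0
    · obtain ⟨i, hi⟩ := hsurj h0
      have hib : i ≠ b := by
        rintro rfl
        rw [hi] at hlast
        have := congrArg Fin.val hlast
        simp at this
        omega
      rw [slater_eq_zero z hib (by simp [hib, hi]), mul_zero]
    · obtain ⟨m, rfl⟩ : ∃ k, m = k + 1 := ⟨m - 1, by have := b.pos; omega⟩
      have hb : b = Fin.last m := by
        by_contra hb
        have := f.strictMono (lt_of_le_of_ne (Fin.le_last b) hb)
        rw [hlast] at this
        exact absurd this (not_lt.2 (Fin.le_last _))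
      subst hb
      rw [hr] at hcard hmem
      set g : Fin (m + 1) → Fin (n + 1) := Fin.cons 0 fun i : Fin m => f i.castSucc with hg
      -- `g` lists the new sites in increasing order: the moved particle now comes first.
      have hgf : Function.update f (Fin.last m) 0 = g ∘ finRotate (m + 1) := by
        funext i
        refine Fin.lastCases ?_ (fun i => ?_) i
        · simp [hg]
        · rw [Function.update_of_ne (Fin.castSucc_lt_last i).ne, Function.comp_apply,
            finRotate_apply, Fin.coeSucc_eq_succ, hg, Fin.cons_succ]
      have hmono : StrictMono g := by
        have hpos (i : Fin m) : 0 < f i.castSucc :=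
          Fin.pos_iff_ne_zero.2 fun h => h0 (h ▸ hfs _)
        intro i j hij
        induction i using Fin.cases with
        | zero =>
          induction j using Fin.cases with
          | zero => exact absurd hij (lt_irrefl _)
          | succ j => simpa [hg] using hpos j
        | succ i =>
          induction j using Fin.cases with
          | zero => exact absurd hij (by simp)
          | succ j =>
            simp only [hg, Fin.cons_succ]
            exact f.strictMono (by simpa using hij)
      have hgmem (i : Fin (m + 1)) : g i ∈ insert 0 (s.erase (f (Fin.last m))) := by
        have := hmem ((finRotate (m + 1)).symm i)
        rwa [hgf, Function.comp_apply, Equiv.apply_symm_apply] at this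
      have hupd : Function.update (fun i => (f i : ℕ)) (Fin.last m) 0 =
          (fun i => (g i : ℕ)) ∘ finRotate (m + 1) := by
        funext i
        have := congrArg Fin.val (congrFun hgf i)
        rw [Function.comp_apply] at this ⊢
        rw [← this]
        by_cases hi : i = Fin.last m
        · subst hi; simp
        · simp [hi]
      rw [amplitude_eq_slater z (hcard h0) hmono hgmem, hupd, slater_comp_perm, sign_finRotate,
        ← mul_assoc]
      have : ((-1 : ℂ) ^ m) * (-1) ^ m = 1 := by rw [← mul_pow]; simp
      simp [this]
  -- Away from the boundary the order of the particles is preserved.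
  · have hval : (finRotate (n + 1) (f b) : ℕ) = f b + 1 :=
      coe_finRotate_of_ne_last hlast
    have hupd : Function.update (fun i => (f i : ℕ)) b ((f b : ℕ) + 1) =
        fun i => (Function.update f b (finRotate (n + 1) (f b)) i : ℕ) := by
      funext i
      by_cases hi : i = b
      · subst hi; simp only [Function.update_self, hval]
      · simp [hi]
    split_ifs with h
    · obtain ⟨i, hi⟩ := hsurj h
      have hib : i ≠ b := by
        rintro rfl
        rw [← hi] at hval
        omega
      exact slater_eq_zero z hib (by
        simp only [Function.update_of_ne hib, Function.update_self, hi, hval])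
    · have hmono : StrictMono (Function.update f b (finRotate (n + 1) (f b))) := by
        intro i j hij
        have hfij := f.strictMono hij
        rw [Fin.lt_def] at hfij ⊢
        by_cases hi : i = b
        · subst hi
          rw [Function.update_self, Function.update_of_ne hij.ne', hval]
          have hne : (finRotate (n + 1) (f i) : ℕ) ≠ f j := fun e =>
            h (Fin.ext e ▸ hfs j)
          omega
        · rw [Function.update_of_ne hi]
          by_cases hj : j = b
          · subst hj
            rw [Function.update_self, hval]
            omega
          · rwa [Function.update_of_ne hj]
      rw [hupd, amplitude_eq_slater z (hcard h) hmono hmem]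

/-- Slater determinants are eigenvectors of the hopping operator. -/
theorem sum_amplitude_hop (hn : 2 ≤ n) {z : Fin m → ℂ}
    (hz : ∀ a, z a ^ n = (-1) ^ (m - 1)) (s : Finset (Fin n)) :
    (∑ j ∈ s, if finRotate n j ∈ s then 0 else
      amplitude z (insert (finRotate n j) (s.erase j))) = (∑ a, z a) * amplitude z s := by
  by_cases hs : s.card = m
  · nth_rewrite 1 [← map_orderEmbOfFin_univ s hs]
    rw [sum_map]
    rw [amplitude, dif_pos hs, ← sum_slater_update_succ]
    refine sum_congr rfl fun b _ => ?_
    rw [slater_hop hn hz hs b]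
    rfl
  · rw [amplitude, dif_neg hs, mul_zero]
    refine sum_eq_zero fun j hj => ?_
    split_ifs with h
    · rfl
    · rw [amplitude, dif_neg]
      rw [card_insert_of_notMem (fun h' => h (mem_of_mem_erase h')), card_erase_of_mem hj]
      have := card_pos.2 ⟨j, hj⟩
      omega

/-- At the configuration `{0, …, m - 1}` the Slater determinant is a Vandermonde determinant. -/
theorem exists_amplitude_ne_zero (hm : m ≤ n) {z : Fin m → ℂ} (hz : Function.Injective z) :
    ∃ s : Finset (Fin n), amplitude z s ≠ 0 := by
  refine ⟨univ.map (Fin.castLEEmb hm), ?_⟩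
  rw [amplitude_eq_slater z (by simp) (Fin.strictMono_castLE hm) (by simp)]
  exact Matrix.det_vandermonde_ne_zero_iff.2 hz

end SpinChain

end

/-! ### The one-way hopping operator -/

section

open Finset

namespace SpinChain

variable {n m : ℕ}

/-- An operator acting on the `j`-th factor changes only the `j`-th coordinate of a configuration. -/
theorem site_mulVec (a : Fin 4) (j : Fin n) (ψ : (Fin n → Fin 2) → ℂ) (x : Fin n → Fin 2) :
    (site a j).mulVec ψ x = ∑ c, pauli a (x j) c * ψ (Function.update x j c) := by
  have h (y : Fin n → Fin 2) : site a j x y =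
      if Function.update x j (y j) = y then pauli a (x j) (y j) else 0 := by
    simp only [site, tensorProd, Matrix.of_apply]
    rw [← mul_prod_erase univ _ (mem_univ j), Function.update_self]
    split_ifs with hy
    · rw [prod_eq_one, mul_one]
      intro k hk
      have hk' := ne_of_mem_erase hk
      have := congrFun hy k
      rw [Function.update_of_ne hk'] at this
      rw [Function.update_of_ne hk', this, Matrix.one_apply_eq]
    · obtain ⟨k, hk⟩ := Function.ne_iff.1 hy
      have hkj : k ≠ j := by
        rintro rfl
        simp at hk
      rw [Function.update_of_ne hkj] at hk
      rw [prod_eq_zero (mem_erase.2 ⟨hkj, mem_univ k⟩), mul_zero]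
      rw [Function.update_of_ne hkj, Matrix.one_apply_ne hk]
  have hinj : Function.Injective fun c : Fin 2 => Function.update x j c :=
    Function.update_injective x j
  rw [Matrix.mulVec, dotProduct, ← sum_subset (subset_univ (univ.map ⟨_, hinj⟩)), sum_map]
  · refine sum_congr rfl fun c _ => ?_
    simp [h]
  · intro y _ hy
    rw [h, if_neg, zero_mul]
    intro hy'
    exact hy (mem_map.2 ⟨y j, mem_univ _, hy'⟩)

theorem site_mul_site_mulVec (a b : Fin 4) {j k : Fin n} (hjk : k ≠ j)
    (ψ : (Fin n → Fin 2) → ℂ) (x : Fin n → Fin 2) :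
    (site a j * site b k).mulVec ψ x = ∑ c, ∑ d, pauli a (x j) c * pauli b (x k) d *
      ψ (Function.update (Function.update x j c) k d) := by
  rw [← Matrix.mulVec_mulVec, site_mulVec]
  refine sum_congr rfl fun c _ => ?_
  rw [site_mulVec, mul_sum]
  refine sum_congr rfl fun d _ => ?_
  rw [Function.update_of_ne hjk, mul_assoc]

/-- The Hamiltonian as a real linear function of its coefficients. -/
noncomputable def hamiltonianLinear (n : ℕ) :
    (Fin 4 × Fin 3 → ℝ) →ₗ[ℝ] Matrix (Fin n → Fin 2) (Fin n → Fin 2) ℂ where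
  toFun := hamiltonian n
  map_add' α β := by
    simp only [hamiltonian, Pi.add_apply, Complex.ofReal_add, add_smul, sum_add_distrib,
      smul_add]
  map_smul' t α := by
    simp only [hamiltonian, Pi.smul_apply, smul_eq_mul, Complex.ofReal_mul, mul_smul,
      RingHom.id_apply, ← smul_sum]
    rw [smul_comm, Complex.coe_smul]

/-- The real parts `XX/4`, `YY/4` and `(n + 1) Z` of the couplings of the one-way hopping
Hamiltonian, up to the normalization `√n`. -/
noncomputable def hopRe (n : ℕ) : Fin 4 × Fin 3 → ℝ :=
  √n • (Pi.single (1, 0) (1 / 4) + Pi.single (2, 1) (1 / 4) + Pi.single (0, 2) ((n : ℝ) + 1))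

/-- The imaginary parts `XY/4` and `-YX/4` of the couplings of the one-way hopping Hamiltonian,
up to the normalization `√n`. -/
noncomputable def hopIm (n : ℕ) : Fin 4 × Fin 3 → ℝ :=
  √n • (Pi.single (1, 1) (1 / 4) - Pi.single (2, 0) (1 / 4))

/-- The one-way hopping Hamiltonian `∑_j (σ⁻_j σ⁺_{j+1} + (n + 1) Z_j)`, which is the
value of the Hamiltonian at a point of `ℂ¹²`. It is not Hermitian. -/
noncomputable def hop (n : ℕ) : Matrix (Fin n → Fin 2) (Fin n → Fin 2) ℂ :=
  hamiltonianLinear n (hopRe n) + Complex.I • hamiltonianLinear n (hopIm n)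

theorem finRotate_ne_self (hn : 2 ≤ n) (j : Fin n) : finRotate n j ≠ j := by
  obtain ⟨n, rfl⟩ : ∃ k, n = k + 2 := ⟨n - 2, by omega⟩
  rw [finRotate_apply]
  simp

theorem hamiltonianLinear_single (hn : n ≠ 0) (a : Fin 4) (b : Fin 3) (c : ℝ) :
    hamiltonianLinear n (√n • Pi.single (a, b) c) =
      ∑ j : Fin n, (c : ℂ) • (site a j * site b.succ (finRotate n j)) := by
  have hs : ((√(n : ℝ) : ℝ) : ℂ) ≠ 0 := by
    have : (0 : ℝ) < n := by exact_mod_cast Nat.pos_of_ne_zero hn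
    exact_mod_cast (Real.sqrt_pos.2 this).ne'
  change hamiltonian n _ = _
  rw [hamiltonian, smul_sum]
  refine sum_congr rfl fun j _ => ?_
  rw [← sum_product', sum_eq_single (a, b)]
  · rw [Pi.smul_apply, Pi.single_eq_same, smul_eq_mul, smul_smul, one_div, Complex.ofReal_inv,
      Complex.ofReal_mul, inv_mul_cancel_left₀ hs]
  · intro p _ hp
    simp [Pi.single_eq_of_ne hp]
  · simp

/-- The occupied sites of a basis configuration, those in state `1`. -/
def occupied (x : Fin n → Fin 2) : Finset (Fin n) := univ.filter fun j => x j = 1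

/-- The hopping term `σ⁻_j σ⁺_k = (X_j X_k + Y_j Y_k + i (X_j Y_k - Y_j X_k)) / 4` together with
the diagonal term `c Z_k`. -/
theorem bond_mulVec {j k : Fin n} (hk : k ≠ j) (c : ℂ) (ψ : (Fin n → Fin 2) → ℂ)
    (x : Fin n → Fin 2) :
    ((((((1 / 4 : ℝ) : ℂ) • (site 1 j * site 1 k) + ((1 / 4 : ℝ) : ℂ) • (site 2 j * site 2 k)) +
      c • (site 0 j * site 3 k)) + Complex.I • (((1 / 4 : ℝ) : ℂ) • (site 1 j * site 2 k) -
        ((1 / 4 : ℝ) : ℂ) • (site 2 j * site 1 k))).mulVec ψ) x =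
    (if x j = 1 ∧ x k = 0 then ψ (Function.update (Function.update x j 0) k 1) else 0) +
      c * (if x k = 1 then -1 else 1) * ψ x := by
  simp only [Matrix.add_mulVec, Matrix.sub_mulVec, Matrix.smul_mulVec, Pi.add_apply,
    Pi.sub_apply, Pi.smul_apply, site_mul_site_mulVec _ _ hk, smul_eq_mul]
  have hx : ψ x = ψ (Function.update (Function.update x j (x j)) k (x k)) := by
    rw [Function.update_eq_self, Function.update_eq_self]
  rw [hx]
  generalize x j = p
  generalize x k = q
  fin_cases p <;> fin_cases q <;> simp [pauli, Fin.sum_univ_two]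
  · linear_combination (1 / 2 * ψ (Function.update (Function.update x j 1) k 0)) * Complex.I_mul_I
  · linear_combination (-1 / 2 * ψ (Function.update (Function.update x j 0) k 1)) * Complex.I_mul_I

theorem occupied_update_update {j k : Fin n} (hk : k ≠ j) (x : Fin n → Fin 2) :
    occupied (Function.update (Function.update x j 0) k 1) =
      insert k ((occupied x).erase j) := by
  ext i
  by_cases hi : i = k
  · subst hi; simp [occupied]
  · by_cases hij : i = j
    · subst hij; simp [occupied, hi]
    · simp [occupied, hi, hij]

/-- On wave functions, `hop n` sums over the configurations which arise when one particle moves to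
the next site, if that is empty, and adds a diagonal term which determines the number of
particles. -/
theorem hop_mulVec (hn : 2 ≤ n) (φ : Finset (Fin n) → ℂ) (x : Fin n → Fin 2) :
    (hop n).mulVec (fun y => φ (occupied y)) x =
      (∑ j ∈ occupied x, if finRotate n j ∈ occupied x then 0 else
        φ (insert (finRotate n j) ((occupied x).erase j))) +
      ((n : ℂ) + 1) * (n - 2 * (occupied x).card) * φ (occupied x) := by
  have hn0 : n ≠ 0 := by omega
  set ψ : (Fin n → Fin 2) → ℂ := fun y => φ (occupied y) with hψ
  have hop_eq : hop n = ∑ j : Fin n,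
      ((((1 / 4 : ℝ) : ℂ) • (site 1 j * site 1 (finRotate n j)) +
        ((1 / 4 : ℝ) : ℂ) • (site 2 j * site 2 (finRotate n j)) +
        ((n + 1 : ℝ) : ℂ) • (site 0 j * site 3 (finRotate n j))) +
        Complex.I • (((1 / 4 : ℝ) : ℂ) • (site 1 j * site 2 (finRotate n j)) -
          ((1 / 4 : ℝ) : ℂ) • (site 2 j * site 1 (finRotate n j)))) := by
    rw [hop, hopRe, hopIm, smul_add, smul_add, smul_sub, map_add, map_add, map_sub,
      hamiltonianLinear_single hn0, hamiltonianLinear_single hn0, hamiltonianLinear_single hn0,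
      hamiltonianLinear_single hn0, hamiltonianLinear_single hn0, ← sum_add_distrib,
      ← sum_add_distrib, ← sum_sub_distrib, smul_sum, ← sum_add_distrib]
    rfl
  have hterm (j : Fin n) := bond_mulVec (finRotate_ne_self hn j) ((n + 1 : ℝ) : ℂ) ψ x
  have hsign : (∑ j : Fin n, if x (finRotate n j) = 1 then (-1 : ℂ) else 1) =
      n - 2 * (occupied x).card := by
    rw [Equiv.sum_comp (finRotate n) fun j => if x j = 1 then (-1 : ℂ) else 1]
    have h (j : Fin n) : (if x j = 1 then (-1 : ℂ) else 1) = 1 - 2 * if x j = 1 then 1 else 0 := by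
      split_ifs <;> norm_num
    simp_rw [h, sum_sub_distrib, ← mul_sum, occupied]
    simp
  rw [hop_eq, Matrix.sum_mulVec, Finset.sum_apply, sum_congr rfl fun j _ => hterm j,
    sum_add_distrib, ← sum_mul, ← mul_sum, hsign]
  congr 1
  swap
  · simp [hψ]
  rw [occupied, sum_filter]
  refine sum_congr rfl fun j _ => ?_
  by_cases h1 : x j = 1
  · by_cases h2 : x (finRotate n j) = 1
    · simp [h1, h2, -finRotate_apply, mem_filter]
    · have h0 : x (finRotate n j) = 0 := by omega
      rw [if_pos ⟨h1, h0⟩, if_pos h1, if_neg (by simpa [-finRotate_apply] using h2), hψ]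
      exact congrArg φ (occupied_update_update (finRotate_ne_self hn j) x)
  · simp [h1]

end SpinChain

end

/-! ### Spectrum of the one-way hopping operator -/

section

open Finset

namespace SpinChain

variable {n : ℕ}

/-- Over the rationals the only linear relation between the powers `1, ω, …, ω^(n-1)` of a primitive
root of unity `ω` of prime order is `1 + ω + ⋯ + ω^(n-1) = 0`, so a set of exponents is determined
by its size and the sum of its powers. -/
theorem eq_of_sum_pow_eq (hn : n.Prime) {ω : ℂ} (hω : IsPrimitiveRoot ω n)
    {S T : Finset (Fin n)} (hcard : S.card = T.card)
    (h : ∑ k ∈ S, ω ^ (k : ℕ) = ∑ k ∈ T, ω ^ (k : ℕ)) : S = T := by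
  classical
  have : Fact n.Prime := ⟨hn⟩
  set c : Fin n → ℚ := fun k => (if k ∈ S then 1 else 0) - (if k ∈ T then 1 else 0) with hc
  set p : Polynomial ℚ := ∑ k : Fin n, Polynomial.C (c k) * Polynomial.X ^ (k : ℕ) with hp
  have hcoeff (k : Fin n) : p.coeff k = c k := by
    rw [hp, Polynomial.finsetSum_coeff, sum_eq_single k]
    · simp
    · intro i _ hi
      rw [Polynomial.coeff_C_mul_X_pow, if_neg fun e => hi (Fin.ext e.symm)]
    · simp
  have hroot : Polynomial.aeval ω p = 0 := by
    simp only [hp, hc, map_sum, map_mul, map_sub, Polynomial.aeval_C, map_pow,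
      Polynomial.aeval_X, sub_mul, sum_sub_distrib, apply_ite (algebraMap ℚ ℂ), map_one,
      map_zero, ite_mul, one_mul, zero_mul, sum_ite_mem, univ_inter, h, sub_self]
  have hdvd : Polynomial.cyclotomic n ℚ ∣ p := by
    rw [Polynomial.cyclotomic_eq_minpoly_rat hω hn.pos]
    exact minpoly.dvd ℚ ω hroot
  have hdeg : p.natDegree ≤ n - 1 := by
    refine Polynomial.natDegree_sum_le_of_forall_le _ _ fun k _ => ?_
    refine (Polynomial.natDegree_C_mul_X_pow_le _ _).trans ?_
    have := k.isLt
    omega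
  obtain ⟨q, hq⟩ := hdvd
  have hq0 : q = Polynomial.C (q.coeff 0) := by
    by_cases hq' : q = 0
    · simp [hq']
    -- The cyclotomic polynomial already has degree `n - 1`.
    refine Polynomial.eq_C_of_natDegree_eq_zero ?_
    have := congrArg Polynomial.natDegree hq
    rw [Polynomial.natDegree_mul (Polynomial.cyclotomic_ne_zero n ℚ) hq',
      Polynomial.natDegree_cyclotomic, Nat.totient_prime hn] at this
    omega
  have hconst (k : Fin n) : c k = q.coeff 0 := by
    rw [← hcoeff, hq, hq0, Polynomial.cyclotomic_prime, Polynomial.coeff_mul_C,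
      Polynomial.finsetSum_coeff, sum_eq_single (k : ℕ)]
    · simp
    · intro i _ hi
      rw [Polynomial.coeff_X_pow, if_neg hi.symm]
    · simp
  have hsum : ∑ k, c k = 0 := by
    simp [hc, sum_sub_distrib, hcard]
  have hzero (k : Fin n) : c k = 0 := by
    have hn0 : (n : ℚ) ≠ 0 := by exact_mod_cast hn.ne_zero
    have := hsum
    simp_rw [hconst, sum_const, card_univ, Fintype.card_fin, nsmul_eq_mul] at this
    rw [hconst]
    exact (mul_eq_zero.1 this).resolve_left hn0
  ext k
  have := hzero k
  by_cases h1 : k ∈ S <;> by_cases h2 : k ∈ T <;> simp [hc, h1, h2] at this ⊢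

/-- The energy of the free fermion state with momenta `S`. -/
noncomputable def energy (ω : ℂ) (S : Finset (Fin n)) : ℂ :=
  (-1) ^ (S.card - 1) * ∑ k ∈ S, ω ^ (k : ℕ) + ((n : ℂ) + 1) * (n - 2 * S.card)

theorem energy_injective (hn : n.Prime) {ω : ℂ} (hω : IsPrimitiveRoot ω n) :
    Function.Injective (energy ω : Finset (Fin n) → ℂ) := by
  intro S T h
  have hbound (U : Finset (Fin n)) :
      ‖(-1 : ℂ) ^ (U.card - 1) * ∑ k ∈ U, ω ^ (k : ℕ)‖ ≤ n := by
    rw [norm_mul, norm_pow, norm_neg, norm_one, one_pow, one_mul]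
    refine (norm_sum_le _ _).trans ?_
    have hω1 : ‖ω‖ = 1 := hω.norm'_eq_one hn.ne_zero
    simp only [norm_pow, hω1, one_pow, sum_const, nsmul_eq_mul, mul_one]
    exact_mod_cast (card_le_univ U).trans_eq (Fintype.card_fin n)
  -- The diagonal term separates the particle numbers, as its steps exceed the hopping energies.
  have hcard : S.card = T.card := by
    by_contra hne
    have h1 : 1 ≤ |(S.card : ℝ) - T.card| := by
      have : 1 ≤ |(S.card : ℤ) - T.card| := Int.one_le_abs (by omega)
      exact_mod_cast this
    have h2 : (-1 : ℂ) ^ (S.card - 1) * ∑ k ∈ S, ω ^ (k : ℕ) -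
        (-1 : ℂ) ^ (T.card - 1) * ∑ k ∈ T, ω ^ (k : ℕ) =
        ((2 * ((n : ℝ) + 1) * ((S.card : ℝ) - T.card) : ℝ) : ℂ) := by
      simp only [energy] at h
      push_cast
      linear_combination h
    have h3 := (norm_sub_le _ _).trans (add_le_add (hbound S) (hbound T))
    rw [h2, Complex.norm_real, Real.norm_eq_abs, abs_mul,
      abs_of_pos (by positivity : (0 : ℝ) < 2 * ((n : ℝ) + 1))] at h3
    nlinarith [(Nat.cast_nonneg n : (0 : ℝ) ≤ n)]
  refine eq_of_sum_pow_eq hn hω hcard ?_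
  simp only [energy, hcard] at h
  exact mul_left_cancel₀ (pow_ne_zero _ (by norm_num : (-1 : ℂ) ≠ 0)) (add_right_cancel h)

theorem hasEigenvalue_hop (hn : 2 ≤ n) (hodd : Odd n) {ω : ℂ} (hω : IsPrimitiveRoot ω n)
    (S : Finset (Fin n)) :
    Module.End.HasEigenvalue (Matrix.toLin' (hop n)) (energy ω S) := by
  set f := S.orderEmbOfFin rfl
  -- The allowed momenta are periodic or antiperiodic according to the particle number.
  set z : Fin S.card → ℂ := fun a => (-1) ^ (S.card - 1) * ω ^ (f a : ℕ) with hz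
  have hzn (a : Fin S.card) : z a ^ n = (-1) ^ (S.card - 1) := by
    rw [hz, mul_pow, ← pow_mul, mul_comm, ← pow_mul, mul_comm (f a : ℕ), pow_mul, hω.pow_eq_one,
      one_pow, one_mul, mul_comm (S.card - 1), pow_mul, hodd.neg_one_pow]
  have hzinj : Function.Injective z := by
    intro a b hab
    have := mul_left_cancel₀ (pow_ne_zero _ (by norm_num : (-1 : ℂ) ≠ 0)) hab
    exact f.injective (Fin.ext (hω.pow_inj (f a).isLt (f b).isLt this))
  have hzsum : ∑ a, z a = (-1) ^ (S.card - 1) * ∑ k ∈ S, ω ^ (k : ℕ) := by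
    rw [hz, ← mul_sum]
    congr 1
    conv_rhs => rw [← map_orderEmbOfFin_univ S rfl, sum_map]
    rfl
  have hSn : S.card ≤ n := (card_le_univ S).trans_eq (Fintype.card_fin n)
  refine Module.End.hasEigenvalue_of_hasEigenvector
    (x := fun y => amplitude z (occupied y)) ⟨?_, ?_⟩
  · rw [Module.End.mem_eigenspace_iff, Matrix.toLin'_apply]
    funext x
    rw [hop_mulVec hn, sum_amplitude_hop hn hzn, hzsum, Pi.smul_apply, smul_eq_mul, energy]
    by_cases hx : (occupied x).card = S.card
    · rw [hx, ← add_mul]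
    · rw [amplitude, dif_neg hx, mul_zero, mul_zero, mul_zero, add_zero]
  · obtain ⟨s, hs⟩ := exists_amplitude_ne_zero hSn hzinj
    intro h0
    have := congrFun h0 fun j => if j ∈ s then 1 else 0
    apply hs
    have hocc : occupied (fun j => if j ∈ s then (1 : Fin 2) else 0) = s := by
      ext j; simp [occupied]
    simpa only [hocc, Pi.zero_apply] using this

/-- The `2 ^ n` energies are distinct, so they exhaust the spectrum and all are simple. -/
theorem separable_charpoly_hop (hn : n.Prime) (hodd : Odd n) : (hop n).charpoly.Separable := by
  set ω := Complex.exp (2 * Real.pi * Complex.I / n)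
  have hω : IsPrimitiveRoot ω n := Complex.isPrimitiveRoot_exp n hn.ne_zero
  have hne : (hop n).charpoly ≠ 0 := (hop n).charpoly_monic.ne_zero
  rw [← Polynomial.nodup_roots_iff_of_splits hne (IsAlgClosed.splits _),
    ← Multiset.toFinset_card_eq_card_iff_nodup]
  refine le_antisymm (Multiset.toFinset_card_le _) ?_
  have hsub : univ.map ⟨energy ω, energy_injective hn hω⟩ ⊆
      (hop n).charpoly.roots.toFinset := by
    intro μ hμ
    obtain ⟨S, -, rfl⟩ := mem_map.1 hμ
    rw [Multiset.mem_toFinset, Polynomial.mem_roots hne, ← Matrix.charpoly_toLin',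
      ← Module.End.hasEigenvalue_iff_isRoot_charpoly]
    exact hasEigenvalue_hop hn.two_le hodd hω S
  refine (Polynomial.card_roots' _).trans ?_
  rw [Matrix.charpoly_natDegree_eq_dim]
  refine le_trans ?_ (card_le_card hsub)
  simp

end SpinChain

end

theorem mainTheorem4 (n : ℕ) (hn : n.Prime) (hodd : Odd n) :
    MeasureTheory.volume
      {α : Fin 4 × Fin 3 → ℝ |
        ¬ SpinChain.NondegenerateSpectrum (SpinChain.hamiltonian n α)} = 0 := by
  rw [← MeasureTheory.ae_iff]
  filter_upwards [Matrix.ae_separable_charpoly MeasureTheory.volume (SpinChain.hamiltonianLinear n)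
    (SpinChain.hopRe n) (SpinChain.hopIm n) (SpinChain.separable_charpoly_hop hn hodd)] with α hα
  exact SpinChain.nondegenerateSpectrum_of_separable hα
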